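/- For a real number $x$ let $\|x\|$ be its distance to the nearest integer, and put $\chi(x)=+1$ if $x-\lfloor x\rfloor<\frac12$ and $\chi(x)=-1$ otherwise. For $t>0$, a vector $(\gamma_1,\dots,\gamma_s)\in\mathbb{R}^s$ is said to be of finite type $t$ if for every $\varepsilon>0$ there is a constant $c=c(\varepsilon,\gamma_1,\dots,\gamma_s)>0$ such that $$\prod_{j=1}^s \max(1,|n_j|)^{t+\varepsilon}\,\Big\|\sum_{j=1}^s n_j\gamma_j\Big\|\ \ge\ c\qquad\text{for all }(n_1,\dots,n_s)\in\mathbb{Z}^s\setminus\{0\}.$$ For a finite sequence $E_N=(e_n)_{n=1}^N\in\{-1,+1\}^N$ the well-distribution measure is $$W(E_N)=\max_{a,b,M}\Big|\sum_{m=1}^M e_{am+b}\Big|,$$ where the maximum is over all integers $a\ge1$, $b\in\mathbb{Z}$, $M\ge1$ with $1\le a+b<aM+b\le N$ (and $W(E_1)=0$, since for $N=1$ there are no such triples). **Theorem.** Let $\alpha_1,\alpha_2,\beta$ be real numbers, let $p\in\mathbb{R}[x]$ be a monic polynomial of degree $d\ge2$, and let $$f(x)=\beta\big\lfloor\alpha_1\lfloor\alpha_2\,p(x)\rfloor\big\rfloor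 .$$ For $N\ge1$ let $E_N=(e_n)_{n=1}^N$ with $e_n=\chi(f(n))$. Let $t>0$ and suppose that $(\alpha_2,\ \alpha_1\alpha_2,\ \alpha_1\alpha_2\beta)$ is of finite type $t$. Then there exists $\eta=\eta(f,t)>0$, depending only on $f$ and $t$, such that for every $\varepsilon>0$ there is a constant $C=C(f,t,\varepsilon)>0$ with $$W(E_N)\le C\,N^{1-\eta+\varepsilon}\qquad\text{for all integers }N\ge1 .$$ -/

import Mathlib

/-- The distance `‖x‖` of a real number to the nearest integer. -/
noncomputable def distNearestInt (x : ℝ) : ℝ := |x - (round x : ℝ)|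

/-- `(γ₁, …, γ_s)` is of finite type `t`: for every `ε > 0` there is `c > 0` such that
`∏ max(1, |n_j|)^(t + ε) * ‖∑ n_j γ_j‖ ≥ c` for all nonzero integer vectors `n`. -/
def IsOfFiniteType {s : ℕ} (γ : Fin s → ℝ) (t : ℝ) : Prop :=
  ∀ ε : ℝ, 0 < ε → ∃ c : ℝ, 0 < c ∧ ∀ n : Fin s → ℤ, n ≠ 0 →
    c ≤ (∏ j, (max 1 |(n j : ℝ)|) ^ (t + ε)) * distNearestInt (∑ j, (n j : ℝ) * γ j)

/-- The sign `χ(x)`: `+1` if the fractional part of `x` is less than `1/2`, and `-1` otherwise. -/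
noncomputable def chiSign (x : ℝ) : ℤ := if x - (⌊x⌋ : ℝ) < 1 / 2 then 1 else -1

/-- The generalized polynomial `f(x) = β ⌊α₁ ⌊α₂ p(x)⌋⌋`. -/
noncomputable def genPoly (α₁ α₂ β : ℝ) (p : Polynomial ℝ) (x : ℝ) : ℝ :=
  β * (⌊α₁ * (⌊α₂ * p.eval x⌋ : ℝ)⌋ : ℝ)

/-- The binary sequence `e_n = χ(f(n))` induced by a real function `f`. -/
noncomputable def inducedSeq (f : ℝ → ℝ) (n : ℤ) : ℤ := chiSign (f (n : ℝ))

/-- The sum `∑_{m=1}^M e_{am+b}` along an arithmetic progression. -/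
def progressionSum (e : ℤ → ℤ) (M a : ℕ) (b : ℤ) : ℤ :=
  ∑ m ∈ Finset.Icc 1 M, e ((a : ℤ) * (m : ℤ) + b)

/-- The values `|∑_{m=1}^M e_{am+b}|` for integers `a ≥ 1`, `b`, `M ≥ 1` with
`1 ≤ a + b < aM + b ≤ N`. Only the terms `e_1, …, e_N` enter. -/
def progressionValues (e : ℤ → ℤ) (N : ℕ) : Set ℝ :=
  {x | ∃ (a : ℕ) (b : ℤ) (M : ℕ), 1 ≤ a ∧ 1 ≤ M ∧
    1 ≤ (a : ℤ) + b ∧ (a : ℤ) + b < (a : ℤ) * (M : ℤ) + b ∧ (a : ℤ) * (M : ℤ) + b ≤ (N : ℤ) ∧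
    x = |(progressionSum e M a b : ℝ)|}

/-- The well-distribution measure `W(E_N)` of `E_N = (e_1, …, e_N)`: the maximum of the values
above (with value `0` if `N ≤ 1`, where no triple `(a, b, M)` is admissible). -/
noncomputable def wellDistribution (e : ℤ → ℤ) (N : ℕ) : ℝ := sSup (progressionValues e N)

/-- For a binary sequence all the values are at most `N`, so the supremum is a genuine one. -/
theorem le_of_mem_progressionValues {e : ℤ → ℤ} (he : ∀ n, |e n| ≤ 1) {N : ℕ} {x : ℝ}
    (hx : x ∈ progressionValues e N) : x ≤ N := by
  obtain ⟨a, b, M, ha, hM, h1, -, h3, rfl⟩ := hx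
  have hs : |progressionSum e M a b| ≤ (M : ℤ) := by
    refine (Finset.abs_sum_le_sum_abs _ _).trans ?_
    refine (Finset.sum_le_sum fun m _ => he _).trans ?_
    simp
  have hMN : (M : ℤ) ≤ N := by
    have ha' : (1 : ℤ) ≤ a := by exact_mod_cast ha
    have hM' : (1 : ℤ) ≤ M := by exact_mod_cast hM
    nlinarith [mul_nonneg (sub_nonneg.2 ha') (sub_nonneg.2 hM')]
  exact_mod_cast hs.trans hMN

/-! Writing each floor as `⌊y⌋ = y - {y}` shows that `χ(f(n))` is a fixed sign function on the
three-dimensional torus, evaluated at `p(n) • (α₂, α₁α₂, α₁α₂β)` (`genPoly_eq`, `torusSign`). That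
function jumps only across a few hypersurfaces and changes sign when the last coordinate moves by
1/2, so it has mean zero. Quantitative equidistribution of these points along progressions is
therefore enough.

Equidistribution comes from Weyl sums. For a frequency `h ≠ 0` the phase is a polynomial with
leading coefficient `(h · γ) a ^ d`. Finite type keeps its integer multiples polynomially far from
the integers, and Weyl differencing then saves any fixed power of `J` once `M` exceeds a larger
power of `J` (`norm_sum_unitExp_eval_le`, `IsOfFiniteType.norm_sum_unitExp_le`).

The passage back to the sign function uses shifted Fejér kernels as a partition of unity on a grid
(`abs_sum_torusSign_le`): grid signs cancel exactly, and grid points near a jump are few. Taking `J`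
of order `N ^ η` finishes the proof, since long progressions inside `[1, N]` have small difference.
-/

open Finset Polynomial

/-! ### The additive character and the distance to the nearest integer -/

/-- The additive character `x ↦ exp (2πix)`. -/
noncomputable def unitExp (x : ℝ) : ℂ := Complex.exp ((2 * Real.pi * x : ℝ) * Complex.I)

theorem unitExp_add (x y : ℝ) : unitExp (x + y) = unitExp x * unitExp y := by
  rw [unitExp, unitExp, unitExp, ← Complex.exp_add]
  congr 1
  push_cast
  ring

@[simp] theorem unitExp_zero : unitExp 0 = 1 := by simp [unitExp]

@[simp] theorem norm_unitExp (x : ℝ) : ‖unitExp x‖ = 1 := Complex.norm_exp_ofReal_mul_I _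

theorem conj_unitExp (x : ℝ) : (starRingEnd ℂ) (unitExp x) = unitExp (-x) := by
  rw [unitExp, unitExp, ← Complex.exp_conj, map_mul, Complex.conj_ofReal, Complex.conj_I]
  congr 1
  push_cast
  ring

theorem unitExp_intCast (n : ℤ) : unitExp n = 1 := by
  rw [unitExp, Complex.exp_eq_one_iff]
  exact ⟨n, by push_cast; ring⟩

theorem unitExp_sum {ι : Type*} (s : Finset ι) (f : ι → ℝ) :
    unitExp (∑ i ∈ s, f i) = ∏ i ∈ s, unitExp (f i) := by
  classical
  induction s using Finset.induction_on with
  | empty => simp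
  | insert a s ha ih => rw [sum_insert ha, prod_insert ha, unitExp_add, ih]

theorem unitExp_nat_mul (n : ℕ) (x : ℝ) : unitExp (n * x) = unitExp x ^ n := by
  rw [unitExp, unitExp, ← Complex.exp_nat_mul]
  congr 1
  push_cast
  ring

theorem distNearestInt_nonneg (x : ℝ) : 0 ≤ distNearestInt x := abs_nonneg _

theorem distNearestInt_le (x : ℝ) (n : ℤ) : distNearestInt x ≤ |x - n| := round_le x n

theorem floor_add_eq_of_abs_lt {y s : ℝ} (h : |s| < distNearestInt y) : ⌊y + s⌋ = ⌊y⌋ := by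
  have h1 := distNearestInt_le y ⌊y⌋
  have h2 := distNearestInt_le y (⌊y⌋ + 1)
  have h3 := Int.floor_le y
  have h4 := Int.lt_floor_add_one y
  rw [abs_of_nonneg (by linarith)] at h1
  push_cast at h2
  rw [abs_of_neg (by linarith)] at h2
  rw [Int.floor_eq_iff]
  have h5 := abs_lt.1 h
  constructor <;> linarith

theorem fract_add_eq_of_abs_lt {y s : ℝ} (h : |s| < distNearestInt y) :
    Int.fract (y + s) = Int.fract y + s := by
  rw [Int.fract, Int.fract, floor_add_eq_of_abs_lt h]
  ring

/-- The chord has length `2 |sin (πx)|`, and Jordan's inequality bounds the sine below after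
reduction of `x` modulo 1 to `[-1/2, 1/2]`. -/
theorem four_mul_distNearestInt_le_norm (x : ℝ) :
    4 * distNearestInt x ≤ ‖unitExp x - 1‖ := by
  have h0 : unitExp x = unitExp (x - round x) := by
    conv_lhs => rw [show x = (x - round x) + (round x : ℤ) by ring, unitExp_add, unitExp_intCast,
      mul_one]
  have hy : |x - round x| ≤ 1 / 2 := abs_sub_round x
  rw [h0, distNearestInt]
  set y := x - round x with hydef
  have h1 : ‖unitExp y - 1‖ = ‖2 * Real.sin (2 * Real.pi * y / 2)‖ := by
    rw [← Complex.norm_exp_I_mul_ofReal_sub_one, unitExp, mul_comm Complex.I]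
  rw [h1, show 2 * Real.pi * y / 2 = Real.pi * y by ring, norm_mul, Real.norm_eq_abs,
    Real.norm_eq_abs, abs_two]
  have h2 : |Real.sin (Real.pi * y)| = Real.sin (Real.pi * |y|) := by
    have hs : 0 ≤ Real.sin (Real.pi * |y|) := by
      apply Real.sin_nonneg_of_nonneg_of_le_pi
      · positivity
      · nlinarith [Real.pi_pos]
    rcases abs_cases y with ⟨h, -⟩ | ⟨h, -⟩
    · rw [h] at hs ⊢
      exact abs_of_nonneg hs
    · rw [h] at hs ⊢
      rw [mul_neg, Real.sin_neg] at hs ⊢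
      exact abs_of_nonpos (by linarith)
  have h3 := Real.mul_le_sin (x := Real.pi * |y|) (by positivity) (by nlinarith [Real.pi_pos])
  rw [h2]
  have h4 : 2 / Real.pi * (Real.pi * |y|) = 2 * |y| := by
    field_simp
  linarith

theorem norm_sum_unitExp_nat_mul_le (L : ℕ) (x : ℝ) :
    ‖∑ n ∈ range L, unitExp (n * x)‖ * distNearestInt x ≤ 1 := by
  have h : (∑ n ∈ range L, unitExp (n * x)) * (unitExp x - 1) = unitExp x ^ L - 1 := by
    simp_rw [unitExp_nat_mul]
    exact geom_sum_mul _ _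
  have h1 : ‖∑ n ∈ range L, unitExp (n * x)‖ * ‖unitExp x - 1‖ ≤ 2 := by
    rw [← norm_mul, h]
    refine (norm_sub_le _ _).trans ?_
    rw [norm_pow, norm_unitExp, one_pow, norm_one]
    norm_num
  have h2 := mul_le_mul_of_nonneg_left (four_mul_distNearestInt_le_norm x)
    (norm_nonneg (∑ n ∈ range L, unitExp (n * x)))
  linarith

/-! ### Weyl sums over polynomials -/

/-- One Weyl differencing step: the degree drops by one and the leading coefficient is multiplied by
the old degree times the difference of the shifts. -/
theorem coeff_taylor_sub_taylor {q : ℝ[X]} {d : ℕ} (hq : q.natDegree ≤ d + 1) (x y : ℝ) :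
    (taylor x q - taylor y q).coeff d = (d + 1) * (x - y) * q.coeff (d + 1) := by
  have h : ∀ z : ℝ, (taylor z q).coeff d = q.coeff d + (d + 1) * z * q.coeff (d + 1) := by
    intro z
    rw [taylor_coeff, hasseDeriv_apply, sum_over_range' _ _ (d + 2) (by omega)]
    · rw [sum_range_succ, sum_range_succ, eval_add, eval_add, eval_finsetSum, sum_eq_zero]
      · simp
        ring
      · intro i hi
        rw [Nat.choose_eq_zero_of_lt (mem_range.1 hi)]
        simp
    · simp
  rw [coeff_sub, h, h]
  ring

theorem natDegree_taylor_sub_taylor_le {q : ℝ[X]} {d : ℕ} (hq : q.natDegree ≤ d + 1) (x y : ℝ) :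
    (taylor x q - taylor y q).natDegree ≤ d := by
  rw [natDegree_le_iff_coeff_eq_zero]
  intro n hn
  rw [coeff_sub]
  rcases Nat.lt_or_ge (d + 1) n with h | h
  · rw [coeff_eq_zero_of_natDegree_lt, coeff_eq_zero_of_natDegree_lt, sub_zero] <;>
    · rw [natDegree_taylor]
      omega
  · obtain rfl : n = d + 1 := by omega
    have h : ∀ z : ℝ, (taylor z q).coeff (d + 1) = q.coeff (d + 1) := by
      intro z
      rw [taylor_coeff, hasseDeriv_apply, sum_over_range' _ _ (d + 2) (by omega)]
      · rw [sum_range_succ, eval_add, eval_finsetSum, sum_eq_zero]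
        · simp
        · intro i hi
          rw [Nat.choose_eq_zero_of_lt (mem_range.1 hi)]
          simp
      · simp
    rw [h, h, sub_self]

/-- Shifting the summation range by `k` changes a sum of unimodular terms by at most `2k`. -/
theorem norm_sum_range_sub_shift_le {z : ℕ → ℂ} (hz : ∀ n, ‖z n‖ ≤ 1) (L k : ℕ) :
    ‖∑ n ∈ range L, z n - ∑ n ∈ range L, z (n + k)‖ ≤ 2 * k := by
  have h1 : ∑ n ∈ range L, z n - ∑ n ∈ range L, z (n + k)
      = ∑ n ∈ range k, z n - ∑ n ∈ range k, z (L + n) := by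
    have e1 := sum_range_add z L k
    have e2 := sum_range_add z k L
    rw [add_comm k L] at e2
    have e3 : ∑ n ∈ range L, z (n + k) = ∑ n ∈ range L, z (k + n) :=
      sum_congr rfl fun n _ => by rw [add_comm]
    rw [e3]
    linear_combination e2 - e1
  have h2 : ∀ w : ℕ → ℂ, (∀ n, ‖w n‖ ≤ 1) → ‖∑ n ∈ range k, w n‖ ≤ k := fun w hw =>
    (norm_sum_le _ _).trans ((sum_le_sum fun n _ => hw n).trans (by simp))
  rw [h1]
  refine (norm_sub_le _ _).trans ?_
  linarith [h2 z hz, h2 (fun n => z (L + n)) fun n => hz _]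

/-- If all correlations of `z` with shifts below `H` are at most `B`, then `∑ z` is small. -/
theorem norm_sum_le_of_correlation_le {z : ℕ → ℂ} (hz : ∀ n, ‖z n‖ = 1) {L H : ℕ} (hH : 0 < H)
    {B : ℝ} (hB0 : 0 ≤ B) (hB : ∀ k < H, ∀ l < H, k ≠ l →
      ‖∑ n ∈ range L, z (n + k) * (starRingEnd ℂ) (z (n + l))‖ ≤ B) :
    ‖∑ n ∈ range L, z n‖ ≤ 2 * H + √(L * (L / H + B)) := by
  have hH' : (0 : ℝ) < H := by exact_mod_cast hH
  set S := ∑ n ∈ range L, z n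
  set T : ℕ → ℂ := fun n => ∑ k ∈ range H, z (n + k)
  -- Van der Corput: averaging over `H` shifts changes the sum little, and the second moment of the
  -- short sums `T n` consists of correlations.
  have h1 : ‖(H : ℂ) * S - ∑ n ∈ range L, T n‖ ≤ H * (2 * H) := by
    have : (H : ℂ) * S - ∑ n ∈ range L, T n
        = ∑ k ∈ range H, (S - ∑ n ∈ range L, z (n + k)) := by
      rw [sum_sub_distrib, sum_comm]
      simp
    rw [this]
    refine (norm_sum_le _ _).trans ((sum_le_sum (g := fun _ => 2 * (H : ℝ)) fun k hk => ?_).trans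
      (by simp))
    refine (norm_sum_range_sub_shift_le (fun n => (hz n).le) L k).trans ?_
    have : (k : ℝ) ≤ H := by exact_mod_cast (mem_range.1 hk).le
    linarith
  have h2 : ∑ n ∈ range L, ‖T n‖ ^ 2 ≤ H * L + H ^ 2 * B := by
    have e1 : ((∑ n ∈ range L, ‖T n‖ ^ 2 : ℝ) : ℂ) = ∑ k ∈ range H, ∑ l ∈ range H,
        ∑ n ∈ range L, z (n + k) * (starRingEnd ℂ) (z (n + l)) := by
      push_cast
      simp_rw [← Complex.mul_conj', T, map_sum, sum_mul_sum]
      rw [sum_comm]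
      exact sum_congr rfl fun k _ => sum_comm
    have e2 : ∑ n ∈ range L, ‖T n‖ ^ 2 = ‖((∑ n ∈ range L, ‖T n‖ ^ 2 : ℝ) : ℂ)‖ := by
      rw [Complex.norm_real, Real.norm_of_nonneg (by positivity)]
    rw [e2, e1]
    have e3 : ∀ k ∈ range H, ∀ l ∈ range H,
        ‖∑ n ∈ range L, z (n + k) * (starRingEnd ℂ) (z (n + l))‖
          ≤ (if k = l then (L : ℝ) else 0) + B := by
      intro k hk l hl
      split_ifs with h
      · refine (norm_sum_le _ _).trans ?_
        simp [hz, hB0]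
      · rw [zero_add]
        exact hB k (mem_range.1 hk) l (mem_range.1 hl) h
    calc _ ≤ ∑ k ∈ range H, ∑ l ∈ range H, ((if k = l then (L : ℝ) else 0) + B) :=
          (norm_sum_le _ _).trans (sum_le_sum fun k hk => (norm_sum_le _ _).trans
            (sum_le_sum fun l hl => e3 k hk l hl))
      _ = H * L + H ^ 2 * B := by
          simp_rw [sum_add_distrib]
          simp only [sum_const, card_range, nsmul_eq_mul, sum_ite_eq, mem_range]
          rw [sum_congr rfl fun k hk => if_pos (mem_range.1 hk)]
          simp
          ring
  -- Cauchy–Schwarz; the diagonal `k = l` gave `H * L`, all other pairs at most `H ^ 2 * B`.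
  have h3 : ‖∑ n ∈ range L, T n‖ ^ 2 ≤ L * (H * L + H ^ 2 * B) := by
    have e1 : ‖∑ n ∈ range L, T n‖ ^ 2 ≤ (∑ n ∈ range L, ‖T n‖) ^ 2 := by
      gcongr
      exact norm_sum_le _ _
    have e2 := sq_sum_le_card_mul_sum_sq (s := range L) (f := fun n => ‖T n‖)
    rw [card_range] at e2
    exact e1.trans (e2.trans (by gcongr))
  have h4 : ‖∑ n ∈ range L, T n‖ ≤ H * √(L * (L / H + B)) := by
    rw [← abs_of_nonneg (norm_nonneg (∑ n ∈ range L, T n))]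
    apply abs_le_of_sq_le_sq _ (by positivity)
    rw [mul_pow, Real.sq_sqrt (by positivity)]
    refine h3.trans (le_of_eq ?_)
    field_simp
  have h5 : H * ‖S‖ ≤ H * (2 * H + √(L * (L / H + B))) := by
    have : H * ‖S‖ = ‖(H : ℂ) * S‖ := by simp
    rw [this]
    have := norm_sub_norm_le ((H : ℂ) * S) (∑ n ∈ range L, T n)
    linarith
  exact le_of_mul_le_mul_left h5 hH'

/-- A Weyl bound for polynomials whose leading coefficient is badly approximable by
rationals with denominators up to a given size. -/
theorem norm_sum_unitExp_eval_le (d : ℕ) : ∀ (R H : ℕ) (M X : ℝ) (q : ℝ[X]), 1 ≤ R →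
    H = R ^ 2 ^ d → (H : ℝ) ^ 2 ≤ M → 0 < X → X * H ≤ M → q.natDegree ≤ d + 1 →
    (∀ n : ℤ, n ≠ 0 → |(n : ℝ)| ≤ (d + 1).factorial * (H : ℝ) ^ d →
      1 / X ≤ distNearestInt (n * q.coeff (d + 1))) →
    ∀ L : ℕ, (L : ℝ) ≤ M → ‖∑ n ∈ range L, unitExp (q.eval (n : ℝ))‖ ≤ 6 * M / R := by
  induction d with
  | zero =>
    intro R H M X q hR hH _ hX hXH hq happ L hL
    have hR' : (0 : ℝ) < R := by exact_mod_cast hR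
    obtain rfl : H = R := by simpa using hH
    have hM : 0 ≤ M := (Nat.cast_nonneg L).trans hL
    have h1 := happ 1 one_ne_zero (by simp)
    rw [Int.cast_one, one_mul, zero_add] at h1
    have h2 : ∑ n ∈ range L, unitExp (q.eval (n : ℝ))
        = unitExp (q.coeff 0) * ∑ n ∈ range L, unitExp (n * q.coeff 1) := by
      rw [mul_sum]
      refine sum_congr rfl fun n _ => ?_
      rw [← unitExp_add, eval_eq_sum_range' (n := 2) (by omega)]
      simp [sum_range_succ]
      ring_nf
    rw [h2, norm_mul, norm_unitExp, one_mul]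
    have h3 := norm_sum_unitExp_nat_mul_le L (q.coeff 1)
    have h4 := mul_le_mul_of_nonneg_left h1 (norm_nonneg (∑ n ∈ range L, unitExp (n * q.coeff 1)))
    have h5 : ‖∑ n ∈ range L, unitExp (n * q.coeff 1)‖ ≤ X := by
      have := h4.trans h3
      rw [mul_one_div, div_le_one hX] at this
      exact this
    refine h5.trans ?_
    rw [le_div_iff₀ hR']
    linarith
  | succ d ih =>
    intro R H M X q hR hH hHM hX hXH hq happ L hL
    have hR' : (1 : ℝ) ≤ R := by exact_mod_cast hR
    have hHpos : 0 < H := by rw [hH]; positivity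
    have hH1 : (0 : ℝ) < H := by exact_mod_cast hHpos
    have hM : 0 ≤ M := (Nat.cast_nonneg L).trans hL
    have hH2 : H = (R ^ 2) ^ 2 ^ d := by rw [hH, ← pow_mul, pow_succ 2 d, mul_comm 2]
    have hRH : (R : ℝ) ^ 2 ≤ H := by
      rw [hH2]
      push_cast
      exact le_self_pow₀ (one_le_pow₀ hR') (by positivity)
    -- Cauchy–Schwarz will take a square root, so the correlations must save `R ^ 2`. The induction
    -- hypothesis at `R ^ 2` gives this with the same `H`.
    have hcorr : ∀ k < H, ∀ l < H, k ≠ l → ‖∑ n ∈ range L, unitExp (q.eval ((n + k : ℕ) : ℝ)) *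
        (starRingEnd ℂ) (unitExp (q.eval ((n + l : ℕ) : ℝ)))‖ ≤ 6 * M / (R ^ 2 : ℕ) := by
      intro k hk l hl hkl
      have := ih (R ^ 2) H M X (taylor (k : ℝ) q - taylor (l : ℝ) q) (Nat.one_le_pow _ _ hR) hH2
        hHM hX hXH (natDegree_taylor_sub_taylor_le hq _ _) ?_ L hL
      · convert this using 3 with n hn
        rw [conj_unitExp, ← unitExp_add]
        simp [taylor_eval, sub_eq_add_neg]
      · intro n hn hnle
        rw [coeff_taylor_sub_taylor hq]
        have hkl' : ((k : ℤ) - l) ≠ 0 := by omega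
        -- The factors `d + 2` and `k - l` from differencing are absorbed into the multiplier; over
        -- all steps they build up the range `(d + 1)! * H ^ d`.
        have h1 := happ (n * ((d + 2 : ℕ) : ℤ) * ((k : ℤ) - l))
          (mul_ne_zero (mul_ne_zero hn (by positivity)) hkl') ?_
        · convert h1 using 2
          push_cast
          ring
        · have h2 : |((k : ℝ) - l)| ≤ H := by
            have hk' : (k : ℝ) ≤ H := by exact_mod_cast hk.le
            have hl' : (l : ℝ) ≤ H := by exact_mod_cast hl.le
            rw [abs_le]
            constructor <;> linarith [(Nat.cast_nonneg k : (0 : ℝ) ≤ k),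
              (Nat.cast_nonneg l : (0 : ℝ) ≤ l)]
          push_cast
          rw [abs_mul, abs_mul, abs_of_nonneg (by positivity : (0 : ℝ) ≤ d + 2)]
          calc |(n : ℝ)| * (d + 2) * |((k : ℝ) - l)|
              ≤ ((d + 1).factorial * (H : ℝ) ^ d) * (d + 2) * H := by gcongr
            _ = _ := by
              rw [Nat.factorial_succ (d + 1)]
              push_cast
              ring
    have hmain := norm_sum_le_of_correlation_le (z := fun n => unitExp (q.eval (n : ℝ)))
      (fun n => norm_unitExp _) hHpos (by positivity) hcorr
    refine hmain.trans ?_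
    have hsq : √(L * (L / H + 6 * M / (R ^ 2 : ℕ))) ≤ 3 * M / R := by
      apply Real.sqrt_le_iff.2 ⟨by positivity, ?_⟩
      calc (L : ℝ) * (L / H + 6 * M / (R ^ 2 : ℕ))
          ≤ M * (M / R ^ 2 + 6 * M / R ^ 2) := by
            push_cast
            gcongr
        _ ≤ (3 * M / R) ^ 2 := by
            have : M * (M / R ^ 2 + 6 * M / R ^ 2) = 7 * (M / R) ^ 2 := by field_simp; ring
            rw [this, mul_div_assoc, mul_pow]
            nlinarith [sq_nonneg (M / R)]
    have hHR : 2 * (H : ℝ) ≤ 2 * M / R := by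
      rw [le_div_iff₀ (by linarith)]
      have : (H : ℝ) * R ≤ H * H := by
        gcongr
        exact_mod_cast (le_self_pow₀ hR' two_ne_zero).trans hRH
      nlinarith
    have : 0 ≤ M / R := by positivity
    have e : 6 * M / R = 2 * M / R + 3 * M / R + M / R := by ring
    linarith

/-! ### The Fejér kernel as a partition of unity -/

/-- The Fejér kernel of order `K`, normalized to have value `1` at the integers. -/
noncomputable def fejer (K : ℕ) (x : ℝ) : ℝ := ‖∑ k ∈ range K, unitExp (k * x)‖ ^ 2 / K ^ 2

theorem fejer_nonneg (K : ℕ) (x : ℝ) : 0 ≤ fejer K x := by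
  rw [fejer]
  positivity

theorem fejer_le {K : ℕ} (hK : 0 < K) {x r : ℝ} (hr : 0 < r) (hx : r < distNearestInt x) :
    fejer K x ≤ 1 / (K ^ 2 * r ^ 2) := by
  have hK' : (0 : ℝ) < K := by exact_mod_cast hK
  have h1 := norm_sum_unitExp_nat_mul_le K x
  have h2 : ‖∑ k ∈ range K, unitExp (k * x)‖ * r ≤ 1 :=
    (mul_le_mul_of_nonneg_left hx.le (norm_nonneg _)).trans h1
  rw [fejer, div_le_div_iff₀ (by positivity) (by positivity)]
  have h3 : (‖∑ k ∈ range K, unitExp (k * x)‖ * r) ^ 2 ≤ 1 :=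
    pow_le_one₀ (by positivity) h2
  nlinarith [mul_le_mul_of_nonneg_left h3 (sq_nonneg (K : ℝ))]

theorem unitExp_div_ne_one {K : ℕ} {n : ℤ} (hn : n ≠ 0) (hnK : |n| < K) :
    unitExp (n / K : ℝ) ≠ 1 := by
  intro h
  have h1 := four_mul_distNearestInt_le_norm (n / K : ℝ)
  rw [h, sub_self, norm_zero] at h1
  have h2 : distNearestInt (n / K : ℝ) = 0 := le_antisymm (by linarith) (distNearestInt_nonneg _)
  rw [distNearestInt, abs_eq_zero, sub_eq_zero] at h2
  have hK : (K : ℝ) ≠ 0 := by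
    rintro hK
    have : K = 0 := by exact_mod_cast hK
    subst this
    exact absurd hnK (by simp)
  rw [div_eq_iff hK] at h2
  have h3 : n = round (n / K : ℝ) * K := by exact_mod_cast h2
  have h4 : (K : ℤ) ∣ n := ⟨_, by rw [mul_comm]; exact h3⟩
  exact hn (Int.eq_zero_of_abs_lt_dvd h4 hnK)

theorem sum_unitExp_grid {K : ℕ} {n : ℤ} (hn : n ≠ 0) (hnK : |n| < K) :
    ∑ j ∈ range K, unitExp (j * (n / K : ℝ)) = 0 := by
  have hK : (K : ℝ) ≠ 0 := by
    rintro hK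
    have : K = 0 := by exact_mod_cast hK
    subst this
    exact absurd hnK (by simp)
  have h := geom_sum_mul (unitExp (n / K : ℝ)) K
  simp_rw [← unitExp_nat_mul] at h
  rw [mul_div_cancel₀ _ hK, unitExp_intCast, sub_self] at h
  exact (mul_eq_zero.1 h).resolve_right (sub_ne_zero.2 (unitExp_div_ne_one hn hnK))

theorem ofReal_norm_sum_unitExp_sq {ι : Type*} (s : Finset ι) (f : ι → ℝ) :
    ((‖∑ k ∈ s, unitExp (f k)‖ ^ 2 : ℝ) : ℂ) = ∑ k ∈ s, ∑ l ∈ s, unitExp (f k - f l) := by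
  push_cast
  rw [← Complex.mul_conj', map_sum, sum_mul_sum]
  simp_rw [conj_unitExp, ← unitExp_add, sub_eq_add_neg]

/-- The kernel only has frequencies of size less than `K`, and summation over the grid kills all of
them except zero. -/
theorem sum_fejer {K : ℕ} (hK : 0 < K) (x : ℝ) : ∑ j : Fin K, fejer K (x - j / K) = 1 := by
  have hK' : (K : ℂ) ≠ 0 := by exact_mod_cast hK.ne'
  rw [← sum_range (fun j => fejer K (x - j / K))]
  simp_rw [fejer]
  rw [← sum_div, div_eq_one_iff_eq (by positivity)]
  apply Complex.ofReal_injective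
  rw [Complex.ofReal_sum]
  simp_rw [ofReal_norm_sum_unitExp_sq]
  rw [sum_comm]
  have h : ∀ k ∈ range K, ∑ j ∈ range K, ∑ l ∈ range K,
      unitExp (k * (x - j / K) - l * (x - j / K)) = K := by
    intro k hk
    rw [sum_comm, sum_eq_single k]
    · simp
    · intro l hl hlk
      rw [mem_range] at hk hl
      have h1 := sum_unitExp_grid (K := K) (n := (l : ℤ) - k) (by omega)
        (by rw [abs_lt]; constructor <;> omega)
      have h2 : ∀ j ∈ range K, unitExp (k * (x - j / K) - l * (x - j / K))
          = unitExp ((k - l) * x) * unitExp (j * ((((l : ℤ) - k : ℤ) : ℝ) / K)) := by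
        intro j _
        rw [← unitExp_add]
        congr 1
        push_cast
        ring
      rw [sum_congr rfl h2, ← mul_sum, h1, mul_zero]
    · intro h
      exact absurd hk h
  rw [sum_congr rfl h]
  simp
  ring

theorem sum_prod_fejer {K : ℕ} (hK : 0 < K) {s : ℕ} (x : Fin s → ℝ) :
    ∑ j : Fin s → Fin K, ∏ i, fejer K (x i - j i / K) = 1 := by
  have := prod_univ_sum (fun _ : Fin s => (univ : Finset (Fin K)))
    (fun i k => fejer K (x i - k / K))
  rw [Fintype.piFinset_univ] at this
  rw [← this]
  exact prod_eq_one fun i _ => sum_fejer hK (x i)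

theorem sum_fin_succ_fun_eq {A : Type*} [AddCommMonoid A] {s K : ℕ} (i : Fin (s + 1))
    (f : (Fin (s + 1) → Fin K) → A) :
    ∑ j, f j = ∑ r : Fin s → Fin K, ∑ k : Fin K, f (i.insertNth k r) := by
  rw [← (Fin.insertNthEquiv (fun _ => Fin K) i).sum_comp, Fintype.sum_prod_type_right]
  rfl

open Classical in
/-- The total weight of the grid points that are far from `x` in the coordinate `i`. -/
theorem sum_far_prod_fejer_le {K : ℕ} (hK : 0 < K) {s : ℕ} (x : Fin (s + 1) → ℝ)
    (i : Fin (s + 1)) {r : ℝ} (hr : 0 < r) :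
    ∑ j : Fin (s + 1) → Fin K, (if r < distNearestInt (x i - j i / K) then (1 : ℝ) else 0) *
      ∏ i, fejer K (x i - j i / K) ≤ 1 / (K * r ^ 2) := by
  have hK' : (0 : ℝ) < K := by exact_mod_cast hK
  rw [sum_fin_succ_fun_eq i]
  -- A far coordinate contributes at most `1 / (K ^ 2 * r ^ 2)` for each of `K` values of `k`; the
  -- other coordinates still sum to 1.
  have h1 : ∀ (ρ : Fin s → Fin K) (k : Fin K),
      (if r < distNearestInt (x i - ((i.insertNth k ρ : Fin (s + 1) → Fin K) i : ℕ) / K)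
        then (1 : ℝ) else 0) *
        ∏ i', fejer K (x i' - ((i.insertNth k ρ : Fin (s + 1) → Fin K) i' : ℕ) / K)
      ≤ 1 / (K ^ 2 * r ^ 2) * ∏ i', fejer K (x (i.succAbove i') - ρ i' / K) := by
    intro ρ k
    rw [Fin.prod_univ_succAbove _ i]
    simp only [Fin.insertNth_apply_same, Fin.insertNth_apply_succAbove]
    rw [← mul_assoc]
    refine mul_le_mul_of_nonneg_right ?_ (prod_nonneg fun _ _ => fejer_nonneg _ _)
    split_ifs with h
    · rw [one_mul]
      exact fejer_le hK hr h
    · rw [zero_mul]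
      positivity
  calc _ ≤ ∑ ρ : Fin s → Fin K, ∑ _k : Fin K,
        1 / (K ^ 2 * r ^ 2) * ∏ i', fejer K (x (i.succAbove i') - ρ i' / K) :=
        sum_le_sum fun ρ _ => sum_le_sum fun k _ => h1 ρ k
    _ = K * (1 / (K ^ 2 * r ^ 2)) * ∑ ρ : Fin s → Fin K,
        ∏ i', fejer K (x (i.succAbove i') - ρ i' / K) := by
        simp [mul_sum, mul_assoc]
    _ = 1 / (K * r ^ 2) := by
        rw [sum_prod_fejer hK (fun i' => x (i.succAbove i'))]
        field_simp

/-- There are `K ^ (2s)` terms, each of weight `K ^ (-2s)`, so a uniform bound on exponential sums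
passes to the kernel without loss. -/
theorem ofReal_prod_fejer {K s : ℕ} (x : Fin s → ℝ) :
    ((∏ i, fejer K (x i) : ℝ) : ℂ) = (∑ k : Fin s → Fin K, ∑ l : Fin s → Fin K,
      unitExp (∑ i, (((k i : ℕ) : ℤ) - (l i : ℕ) : ℤ) * x i)) / (K ^ s) ^ 2 := by
  have h1 : ∏ i, fejer K (x i)
      = ‖∑ k : Fin s → Fin K, unitExp (∑ i, (k i : ℕ) * x i)‖ ^ 2 / (K ^ s) ^ 2 := by
    have := prod_univ_sum (fun _ : Fin s => (univ : Finset (Fin K)))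
      (fun i k => unitExp ((k : ℕ) * x i))
    rw [Fintype.piFinset_univ] at this
    simp_rw [unitExp_sum]
    rw [← this, norm_prod, ← prod_pow]
    simp_rw [fejer, sum_range]
    rw [prod_div_distrib]
    congr 1
    rw [prod_const, card_univ, Fintype.card_fin, ← pow_mul, ← pow_mul, mul_comm]
  rw [h1, Complex.ofReal_div, ofReal_norm_sum_unitExp_sq]
  congr 1
  · refine sum_congr rfl fun k _ => sum_congr rfl fun l _ => ?_
    rw [← sum_sub_distrib]
    congr 1
    refine sum_congr rfl fun i _ => ?_
    push_cast
    ring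
  · push_cast
    rfl

/-- If the exponential sums of `x` at all nonzero frequencies of size less than `K` are at most
`E`, then every grid cell receives the expected weight up to an error `E`. -/
theorem abs_sum_prod_fejer_sub_le {K s M : ℕ} (hK : 0 < K) {x : ℕ → Fin s → ℝ} {E : ℝ}
    (hE0 : 0 ≤ E)
    (hE : ∀ h : Fin s → ℤ, h ≠ 0 → (∀ i, |h i| < K) →
      ‖∑ m ∈ range M, unitExp (∑ i, h i * x m i)‖ ≤ E) (y : Fin s → ℝ) :
    |∑ m ∈ range M, ∏ i, fejer K (x m i - y i) - M / K ^ s| ≤ E := by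
  have hK' : (0 : ℝ) < K := by exact_mod_cast hK
  set T : (Fin s → Fin K) → (Fin s → Fin K) → ℂ := fun k l =>
    ∑ m ∈ range M, unitExp (∑ i, (((k i : ℕ) : ℤ) - (l i : ℕ) : ℤ) * (x m i - y i)) with hT
  have hdiag : ∀ k, T k k = M := by
    intro k
    simp [hT]
  have hoff : ∀ k l, k ≠ l → ‖T k l‖ ≤ E := by
    intro k l hkl
    set h : Fin s → ℤ := fun i => ((k i : ℕ) : ℤ) - (l i : ℕ) with hh
    have h0 : h ≠ 0 := by
      intro h0
      apply hkl
      funext i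
      have := congrFun h0 i
      simp only [hh, Pi.zero_apply] at this
      exact Fin.ext (by omega)
    have h1 : T k l = unitExp (-∑ i, h i * y i) * ∑ m ∈ range M, unitExp (∑ i, h i * x m i) := by
      rw [mul_sum]
      refine sum_congr rfl fun m _ => ?_
      rw [← unitExp_add]
      congr 1
      rw [neg_add_eq_sub, ← sum_sub_distrib]
      exact sum_congr rfl fun i _ => by rw [hh]; ring
    rw [h1, norm_mul, norm_unitExp, one_mul]
    refine hE h h0 fun i => ?_
    have := (k i).2
    have := (l i).2
    rw [abs_lt]
    constructor <;> simp only [hh] <;> omega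
  have h1 : ((∑ m ∈ range M, ∏ i, fejer K (x m i - y i) - M / K ^ s : ℝ) : ℂ)
      = (∑ k, ∑ l, (T k l - if k = l then (M : ℂ) else 0)) / (K ^ s) ^ 2 := by
    rw [Complex.ofReal_sub, Complex.ofReal_sum]
    simp_rw [ofReal_prod_fejer, sum_sub_distrib]
    rw [← sum_div, sub_div, sum_comm]
    congr 2
    · refine sum_congr rfl fun k _ => ?_
      rw [sum_comm]
    · have hKc : (K : ℂ) ≠ 0 := by exact_mod_cast hK.ne'
      simp
      field_simp
  have h2 : ∀ k l, ‖T k l - if k = l then (M : ℂ) else 0‖ ≤ E := by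
    intro k l
    split_ifs with h
    · rw [h, hdiag, sub_self, norm_zero]
      exact hE0
    · rw [sub_zero]
      exact hoff k l h
  rw [← Real.norm_eq_abs, ← Complex.norm_real, h1, norm_div]
  have h3 : ‖((K : ℂ) ^ s) ^ 2‖ = ((K : ℝ) ^ s) ^ 2 := by simp
  rw [h3, div_le_iff₀ (by positivity)]
  calc _ ≤ ∑ _k : Fin s → Fin K, ∑ _l : Fin s → Fin K, E :=
        (norm_sum_le _ _).trans (sum_le_sum fun k _ => (norm_sum_le _ _).trans
          (sum_le_sum fun l _ => h2 k l))
    _ = E * ((K : ℝ) ^ s) ^ 2 := by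
        simp
        ring

open Classical in
theorem sum_grid_near_le {K : ℕ} (hK : 0 < K) (c r : ℝ) (hr : 0 ≤ r) :
    ∑ k : Fin K, (if distNearestInt (k / K - c) ≤ r then (1 : ℝ) else 0) ≤ 2 * K * r + 1 := by
  have hK' : (0 : ℝ) < K := by exact_mod_cast hK
  rw [sum_boole]
  set A := (univ : Finset (Fin K)).filter fun k : Fin K =>
    distNearestInt (((k : ℕ) : ℝ) / K - c) ≤ r
  set B := Finset.Icc ⌈K * (c - r)⌉ ⌊K * (c + r)⌋
  have hAB : A.card ≤ B.card := by
    -- Each index is moved by a multiple of `K` into the window around `K * c`. Distinct indices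
    -- below `K` are incongruent modulo `K`, hence injectivity.
    apply card_le_card_of_injOn (fun k : Fin K => ((k : ℕ) : ℤ) - K * round (((k : ℕ) : ℝ) / K - c))
    · intro k hk
      have h1 : distNearestInt (k / K - c) ≤ r := (mem_filter.1 hk).2
      rw [distNearestInt, abs_le] at h1
      have h2 : ((k : ℕ) : ℝ) / K * K = (k : ℕ) := div_mul_cancel₀ _ hK'.ne'
      rw [mem_coe, mem_Icc, Int.ceil_le, Int.le_floor]
      push_cast
      constructor <;> nlinarith
    · intro k _ l _ hkl
      simp only at hkl
      have h1 : ((k : ℕ) : ℤ) - (l : ℕ) = K * (round (k / K - c : ℝ) - round (l / K - c : ℝ)) := by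
        linear_combination hkl
      have h2 := Int.eq_zero_of_abs_lt_dvd (m := K) (x := ((k : ℕ) : ℤ) - (l : ℕ)) ⟨_, h1⟩ (by
        have := k.2
        have := l.2
        rw [abs_lt]
        constructor <;> omega)
      exact Fin.ext (by omega)
  have hB : (B.card : ℝ) ≤ 2 * K * r + 1 := by
    rw [Int.card_Icc]
    have h1 := Int.le_ceil (K * (c - r))
    have h2 := Int.floor_le (K * (c + r))
    have h3 : (((⌊K * (c + r)⌋ + 1 - ⌈K * (c - r)⌉).toNat : ℤ) : ℝ) ≤ 2 * K * r + 1 := by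
      rw [Int.toNat_eq_max]
      push_cast
      apply max_le
      · linarith
      · positivity
    exact_mod_cast h3
  exact le_trans (by exact_mod_cast hAB) hB

/-! ### The sign of the generalized polynomial as a function on the torus -/

theorem chiSign_add_int (x : ℝ) (n : ℤ) : chiSign (x + n) = chiSign x := by
  rw [chiSign, chiSign, Int.floor_add_intCast]
  push_cast
  rw [add_sub_add_right_eq_sub]

/-- In this form stability of floors gives stability of `χ` away from integers and half-integers. -/
theorem chiSign_eq_ite_floor (x : ℝ) : chiSign x = if ⌊x - 1 / 2⌋ < ⌊x⌋ then 1 else -1 := by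
  rw [chiSign]
  congr 1
  rw [Int.floor_lt, eq_iff_iff]
  constructor <;> intro h <;> linarith

theorem abs_chiSign (x : ℝ) : |chiSign x| = 1 := by
  rw [chiSign]
  split_ifs <;> simp

theorem chiSign_add_half (x : ℝ) : chiSign (x + 1 / 2) = -chiSign x := by
  rw [chiSign_eq_ite_floor (x + 1 / 2), chiSign_eq_ite_floor x, add_sub_cancel_right]
  have h1 : ⌊x + 1 / 2⌋ = ⌊x - 1 / 2⌋ + 1 := by
    rw [← Int.floor_add_one]
    congr 1
    ring
  have h2 : ⌊x - 1 / 2⌋ ≤ ⌊x⌋ := Int.floor_mono (by linarith)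
  have h3 : ⌊x⌋ ≤ ⌊x + 1 / 2⌋ := Int.floor_mono (by linarith)
  split_ifs <;> omega

theorem chiSign_add_eq_of_abs_lt {z s : ℝ} (h1 : |s| < distNearestInt z)
    (h2 : |s| < distNearestInt (z - 1 / 2)) : chiSign (z + s) = chiSign z := by
  rw [chiSign_eq_ite_floor, chiSign_eq_ite_floor, floor_add_eq_of_abs_lt h1,
    show z + s - 1 / 2 = z - 1 / 2 + s by ring, floor_add_eq_of_abs_lt h2]

/-- As `K` is even, the grid is invariant under the shift by 1/2, which reverses `χ`. -/
theorem sum_chiSign_grid {K : ℕ} (hK : 0 < K) (hK2 : Even K) (c : ℝ) :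
    ∑ k : Fin K, chiSign (k / K - c) = 0 := by
  obtain ⟨H, rfl⟩ := hK2
  have hH : (H : ℝ) ≠ 0 := by
    have : H ≠ 0 := by omega
    exact_mod_cast this
  rw [← sum_range (fun k => chiSign (k / ((H + H : ℕ) : ℝ) - c)), sum_range_add,
    ← sum_add_distrib]
  refine sum_eq_zero fun k _ => ?_
  have : ((H + k : ℕ) : ℝ) / ((H + H : ℕ) : ℝ) - c = (k / ((H + H : ℕ) : ℝ) - c) + 1 / 2 := by
    push_cast
    field_simp
    ring
  rw [this, chiSign_add_half, add_neg_cancel]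

/-- The phase shift `α₁β{u} + β{v - α₁{u}}`. -/
noncomputable def phaseShift (α₁ β u v : ℝ) : ℝ :=
  α₁ * β * Int.fract u + β * Int.fract (v - α₁ * Int.fract u)

theorem genPoly_eq (α₁ α₂ β : ℝ) (p : ℝ[X]) (x : ℝ) :
    genPoly α₁ α₂ β p x = α₁ * α₂ * β * p.eval x
      - phaseShift α₁ β (α₂ * p.eval x) (α₁ * α₂ * p.eval x) := by
  have h1 : α₁ * (⌊α₂ * p.eval x⌋ : ℝ)
      = α₁ * α₂ * p.eval x - α₁ * Int.fract (α₂ * p.eval x) := by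
    rw [Int.fract]
    ring
  rw [genPoly, h1, phaseShift]
  set y := α₁ * α₂ * p.eval x - α₁ * Int.fract (α₂ * p.eval x) with hy
  rw [show Int.fract y = y - ⌊y⌋ from rfl, hy]
  ring

/-- The function on the three-dimensional torus that induces the sequence. -/
noncomputable def torusSign (α₁ β : ℝ) (x : Fin 3 → ℝ) : ℤ :=
  chiSign (x 2 - phaseShift α₁ β (x 0) (x 1))

/-- `y` is within a multiple of `δ` of the discontinuities of `torusSign`. -/
def NearJump (α₁ β δ : ℝ) (y : Fin 3 → ℝ) : Prop :=
  distNearestInt (y 0) ≤ δ ∨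
  distNearestInt (y 1 - α₁ * Int.fract (y 0)) ≤ (1 + |α₁|) * δ ∨
  distNearestInt (y 2 - phaseShift α₁ β (y 0) (y 1))
    ≤ (1 + |α₁ * β| + |β| * (1 + |α₁|)) * δ ∨
  distNearestInt (y 2 - (phaseShift α₁ β (y 0) (y 1) + 1 / 2))
    ≤ (1 + |α₁ * β| + |β| * (1 + |α₁|)) * δ

theorem exists_eq_add_int_add (x y : ℝ) :
    ∃ (n : ℤ) (s : ℝ), x = y + s + n ∧ |s| = distNearestInt (x - y) :=
  ⟨round (x - y), x - y - round (x - y), by ring, rfl⟩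

/-- As long as no jump is crossed, fractional parts move exactly as their arguments do. The factors
in `NearJump` bound the resulting displacements of the inner argument and of the argument of `χ`. -/
theorem torusSign_eq_of_not_nearJump {α₁ β δ : ℝ} {x y : Fin 3 → ℝ}
    (hxy : ∀ i, distNearestInt (x i - y i) ≤ δ) (hy : ¬ NearJump α₁ β δ y) :
    torusSign α₁ β x = torusSign α₁ β y := by
  simp only [NearJump, not_or, not_le] at hy
  obtain ⟨b0, b1, b2, b3⟩ := hy
  obtain ⟨n0, s0, e0, h0⟩ := exists_eq_add_int_add (x 0) (y 0)
  obtain ⟨n1, s1, e1, h1⟩ := exists_eq_add_int_add (x 1) (y 1)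
  obtain ⟨n2, s2, e2, h2⟩ := exists_eq_add_int_add (x 2) (y 2)
  replace h0 : |s0| ≤ δ := h0.trans_le (hxy 0)
  replace h1 : |s1| ≤ δ := h1.trans_le (hxy 1)
  replace h2 : |s2| ≤ δ := h2.trans_le (hxy 2)
  have f0 : Int.fract (x 0) = Int.fract (y 0) + s0 := by
    rw [e0, Int.fract_add_intCast, fract_add_eq_of_abs_lt (h0.trans_lt b0)]
  have t1 : |s1 - α₁ * s0| ≤ (1 + |α₁|) * δ := by
    calc |s1 - α₁ * s0| ≤ |s1| + |α₁ * s0| := abs_sub _ _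
      _ ≤ δ + |α₁| * δ := by
        rw [abs_mul]
        gcongr
      _ = _ := by ring
  have f1 : Int.fract (x 1 - α₁ * Int.fract (x 0))
      = Int.fract (y 1 - α₁ * Int.fract (y 0)) + (s1 - α₁ * s0) := by
    rw [f0, e1, show y 1 + s1 + n1 - α₁ * (Int.fract (y 0) + s0)
      = y 1 - α₁ * Int.fract (y 0) + (s1 - α₁ * s0) + n1 by ring, Int.fract_add_intCast,
      fract_add_eq_of_abs_lt (t1.trans_lt b1)]
  set s := s2 - α₁ * β * s0 - β * (s1 - α₁ * s0) with hs
  have t2 : |s| ≤ (1 + |α₁ * β| + |β| * (1 + |α₁|)) * δ := by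
    calc |s| ≤ |s2| + |α₁ * β * s0| + |β * (s1 - α₁ * s0)| :=
          (abs_sub _ _).trans (add_le_add_left (abs_sub _ _) _)
      _ ≤ δ + |α₁ * β| * δ + |β| * ((1 + |α₁|) * δ) := by
        rw [abs_mul (α₁ * β), abs_mul β]
        gcongr
      _ = _ := by ring
  have f2 : x 2 - phaseShift α₁ β (x 0) (x 1)
      = y 2 - phaseShift α₁ β (y 0) (y 1) + s + n2 := by
    rw [phaseShift, phaseShift, f1, f0, e2]
    ring
  rw [torusSign, torusSign, f2, chiSign_add_int]
  refine chiSign_add_eq_of_abs_lt (t2.trans_lt b2) (t2.trans_lt ?_)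
  rwa [sub_sub]

/-- The point of the grid of mesh `1/K` with index `j`. -/
noncomputable def gridPoint {K : ℕ} (j : Fin 3 → Fin K) : Fin 3 → ℝ := fun i => (j i : ℕ) / K

theorem sum_torusSign_gridPoint {K : ℕ} (hK : 0 < K) (hK2 : Even K) (α₁ β : ℝ) :
    ∑ j : Fin 3 → Fin K, torusSign α₁ β (gridPoint j) = 0 := by
  rw [sum_fin_succ_fun_eq 2]
  refine sum_eq_zero fun r _ => ?_
  rw [← sum_chiSign_grid hK hK2 (phaseShift α₁ β ((r 0 : ℕ) / K) ((r 1 : ℕ) / K))]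
  rfl

open Classical in
theorem sum_ite_grid_le {K : ℕ} {P : (Fin 3 → Fin K) → Prop} (i : Fin 3) {B : ℝ}
    (h : ∀ r : Fin 2 → Fin K,
      ∑ k : Fin K, (if P (i.insertNth k r) then (1 : ℝ) else 0) ≤ B) :
    ∑ j : Fin 3 → Fin K, (if P j then (1 : ℝ) else 0) ≤ K ^ 2 * B := by
  rw [sum_fin_succ_fun_eq i]
  refine (sum_le_sum fun r _ => h r).trans ?_
  simp

open Classical in
-- Each of the four conditions, with two coordinates fixed, confines the remaining one to a short
-- window modulo 1.
theorem sum_nearJump_le {K : ℕ} (hK : 0 < K) (α₁ β : ℝ) {δ : ℝ} (hδ : 0 ≤ δ) :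
    ∑ j : Fin 3 → Fin K, (if NearJump α₁ β δ (gridPoint j) then (1 : ℝ) else 0)
      ≤ K ^ 2 * (2 * K * δ + 1) + K ^ 2 * (2 * K * ((1 + |α₁|) * δ) + 1)
        + K ^ 2 * (2 * K * ((1 + |α₁ * β| + |β| * (1 + |α₁|)) * δ) + 1)
        + K ^ 2 * (2 * K * ((1 + |α₁ * β| + |β| * (1 + |α₁|)) * δ) + 1) := by
  have h0 := sum_ite_grid_le (K := K) (P := fun j => distNearestInt (gridPoint j 0) ≤ δ) 0
    fun r => by
      have := sum_grid_near_le hK 0 δ hδ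
      simp only [sub_zero] at this
      exact this
  have h1 := sum_ite_grid_le (K := K) (P := fun j => distNearestInt
    (gridPoint j 1 - α₁ * Int.fract (gridPoint j 0)) ≤ (1 + |α₁|) * δ) 1
    fun r => sum_grid_near_le hK (α₁ * Int.fract (((r 0 : ℕ) : ℝ) / K)) _ (by positivity)
  have h2 := sum_ite_grid_le (K := K) (P := fun j => distNearestInt
    (gridPoint j 2 - phaseShift α₁ β (gridPoint j 0) (gridPoint j 1))
      ≤ (1 + |α₁ * β| + |β| * (1 + |α₁|)) * δ) 2
    fun r => sum_grid_near_le hK (phaseShift α₁ β (((r 0 : ℕ) : ℝ) / K) (((r 1 : ℕ) : ℝ) / K)) _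
      (by positivity)
  have h3 := sum_ite_grid_le (K := K) (P := fun j => distNearestInt
    (gridPoint j 2 - (phaseShift α₁ β (gridPoint j 0) (gridPoint j 1) + 1 / 2))
      ≤ (1 + |α₁ * β| + |β| * (1 + |α₁|)) * δ) 2
    fun r => sum_grid_near_le hK
      (phaseShift α₁ β (((r 0 : ℕ) : ℝ) / K) (((r 1 : ℕ) : ℝ) / K) + 1 / 2) _ (by positivity)
  refine le_trans ?_ (add_le_add (add_le_add (add_le_add h0 h1) h2) h3)
  simp_rw [← sum_add_distrib]
  refine sum_le_sum fun j _ => ?_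
  have hor : ∀ (P Q R S : Prop) [Decidable (P ∨ Q ∨ R ∨ S)],
      (if P ∨ Q ∨ R ∨ S then (1 : ℝ) else 0) ≤ (if P then 1 else 0) + (if Q then 1 else 0)
        + (if R then 1 else 0) + (if S then 1 else 0) := by
    intro P Q R S _
    by_cases hP : P <;> by_cases hQ : Q <;> by_cases hR : R <;> by_cases hS : S <;>
      simp only [hP, hQ, hR, hS, or_true, or_false, if_true, if_false] <;> norm_num
  exact @hor _ _ _ _ (_)

open Classical in
/-- Replacing `x` by the grid points, weighted by the Fejér kernel. -/
theorem abs_torusSign_sub_le {K : ℕ} (hK : 0 < K) (α₁ β : ℝ) {δ : ℝ} (hδ : 0 < δ)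
    (x : Fin 3 → ℝ) :
    |(torusSign α₁ β x : ℝ) - ∑ j : Fin 3 → Fin K,
        (torusSign α₁ β (gridPoint j) : ℝ) * ∏ i, fejer K (x i - gridPoint j i)|
      ≤ 2 * (∑ j : Fin 3 → Fin K, (if NearJump α₁ β δ (gridPoint j) then (1 : ℝ) else 0) *
        ∏ i, fejer K (x i - gridPoint j i)) + 6 / (K * δ ^ 2) := by
  set Φ : (Fin 3 → Fin K) → ℝ := fun j => ∏ i, fejer K (x i - gridPoint j i) with hΦ
  have hΦ0 : ∀ j, 0 ≤ Φ j := fun j => prod_nonneg fun _ _ => fejer_nonneg _ _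
  have hΦ1 : ∑ j, Φ j = 1 := sum_prod_fejer hK x
  have h1 : (torusSign α₁ β x : ℝ) - ∑ j, (torusSign α₁ β (gridPoint j) : ℝ) * Φ j
      = ∑ j, ((torusSign α₁ β x : ℝ) - torusSign α₁ β (gridPoint j)) * Φ j := by
    simp_rw [sub_mul, sum_sub_distrib]
    rw [← mul_sum, hΦ1, mul_one]
  have habs : ∀ y, |(torusSign α₁ β y : ℝ)| = 1 := fun y => by
    rw [torusSign]
    exact_mod_cast abs_chiSign _
  have h2 : ∀ j, |((torusSign α₁ β x : ℝ) - torusSign α₁ β (gridPoint j)) * Φ j|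
      ≤ 2 * ((if NearJump α₁ β δ (gridPoint j) then (1 : ℝ) else 0) * Φ j)
        + 2 * ∑ i, (if δ < distNearestInt (x i - (j i : ℕ) / K) then (1 : ℝ) else 0) * Φ j := by
    intro j
    have hsum0 : 0 ≤ ∑ i, (if δ < distNearestInt (x i - (j i : ℕ) / K) then (1 : ℝ) else 0) * Φ j :=
      sum_nonneg fun i _ => mul_nonneg (by split_ifs <;> norm_num) (hΦ0 j)
    have hle2 : |((torusSign α₁ β x : ℝ) - torusSign α₁ β (gridPoint j)) * Φ j| ≤ 2 * Φ j := by
      rw [abs_mul, abs_of_nonneg (hΦ0 j)]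
      refine mul_le_mul_of_nonneg_right ((abs_sub _ _).trans ?_) (hΦ0 j)
      rw [habs, habs]
      norm_num
    -- Away from the jumps, the two signs can differ only if some coordinate of `x` is farther than
    -- `δ` from the grid point.
    by_cases hb : NearJump α₁ β δ (gridPoint j)
    · rw [if_pos hb, one_mul]
      linarith
    · rw [if_neg hb, zero_mul, mul_zero, zero_add]
      by_cases hn : ∀ i, distNearestInt (x i - gridPoint j i) ≤ δ
      · rw [torusSign_eq_of_not_nearJump hn hb, sub_self, zero_mul, abs_zero]
        linarith
      · push Not at hn
        obtain ⟨i, hi⟩ := hn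
        refine hle2.trans (mul_le_mul_of_nonneg_left ?_ zero_le_two)
        refine le_trans (le_of_eq ?_) (single_le_sum (f := fun i =>
          (if δ < distNearestInt (x i - (j i : ℕ) / K) then (1 : ℝ) else 0) * Φ j)
          (fun i _ => mul_nonneg (by split_ifs <;> norm_num) (hΦ0 j)) (mem_univ i))
        have hi' : δ < distNearestInt (x i - (j i : ℕ) / K) := hi
        simp only [if_pos hi', one_mul]
  rw [h1]
  refine (abs_sum_le_sum_abs _ _).trans ((sum_le_sum fun j _ => h2 j).trans ?_)
  rw [sum_add_distrib, ← mul_sum, ← mul_sum, sum_comm]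
  have h3 : ∑ i, ∑ j : Fin 3 → Fin K,
      (if δ < distNearestInt (x i - (j i : ℕ) / K) then (1 : ℝ) else 0) * Φ j
      ≤ ∑ _i : Fin 3, 1 / (K * δ ^ 2) :=
    sum_le_sum fun i _ => sum_far_prod_fejer_le hK x i hδ
  rw [sum_const, card_univ, Fintype.card_fin, nsmul_eq_mul] at h3
  have e : 6 / (K * δ ^ 2) = 2 * (((3 : ℕ) : ℝ) * (1 / (K * δ ^ 2))) := by
    push_cast
    ring
  rw [e]
  gcongr

/-- A bound for sums of `torusSign` along a sequence in terms of its exponential sums. -/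
theorem abs_sum_torusSign_le (α₁ β : ℝ) : ∃ C : ℝ, 0 < C ∧ ∀ (J M : ℕ), 0 < J → Even J →
    ∀ x : ℕ → Fin 3 → ℝ,
    (∀ h : Fin 3 → ℤ, h ≠ 0 → (∀ i, |h i| < (J ^ 3 : ℕ)) →
      ‖∑ m ∈ range M, unitExp (∑ i, h i * x m i)‖ ≤ 6 * M / (J ^ 10 : ℕ)) →
    |∑ m ∈ range M, (torusSign α₁ β (x m) : ℝ)| ≤ C * M / J := by
  classical
  set L₁ : ℝ := 1 + |α₁|
  set L : ℝ := 1 + |α₁ * β| + |β| * (1 + |α₁|)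
  have hL₁ : 0 ≤ L₁ := by positivity
  have hL : 0 ≤ L := by positivity
  set A : ℝ := 6 + 2 * L₁ + 4 * L
  have hA : 0 ≤ A := by positivity
  refine ⟨12 + 14 * A, by positivity, fun J M hJ hJ2 x hE => ?_⟩
  have hJ' : (1 : ℝ) ≤ J := by exact_mod_cast hJ
  have hJ0 : (0 : ℝ) < J := by linarith
  -- With `δ = 1 / J` this gives `K * δ ^ 2 = J` and `K * δ = J ^ 2`. The saving `J ^ 10` then beats
  -- the `K ^ 3 = J ^ 9` grid points, so every error is `O(M / J)`.
  set K : ℕ := J ^ 3 with hKdef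
  have hK : 0 < K := by positivity
  have hK2 : Even K := hJ2.pow_of_ne_zero (by norm_num)
  have hKJ : (K : ℝ) = (J : ℝ) ^ 3 := by rw [hKdef]; push_cast; rfl
  set E : ℝ := 6 * M / (J ^ 10 : ℕ) with hEdef
  have hE0 : 0 ≤ E := by positivity
  have hKE : (K : ℝ) ^ 3 * E = 6 * M / J := by
    rw [hKJ, hEdef]
    push_cast
    field_simp
  set δ : ℝ := 1 / J with hδdef
  have hδ : 0 < δ := by positivity
  set w : (Fin 3 → Fin K) → ℝ := fun j => ∑ m ∈ range M, ∏ i, fejer K (x m i - gridPoint j i)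
    with hw
  have hwE : ∀ j, |w j - M / K ^ 3| ≤ E := fun j =>
    abs_sum_prod_fejer_sub_le hK hE0 hE (gridPoint j)
  have hmain : |∑ j, (torusSign α₁ β (gridPoint j) : ℝ) * w j| ≤ 6 * M / J := by
    have h0 : ∑ j : Fin 3 → Fin K, (torusSign α₁ β (gridPoint j) : ℝ) = 0 := by
      exact_mod_cast sum_torusSign_gridPoint hK hK2 α₁ β
    have h1 : ∑ j, (torusSign α₁ β (gridPoint j) : ℝ) * w j
        -- The expected weight may be subtracted for free because the grid signs sum to zero.
        = ∑ j, (torusSign α₁ β (gridPoint j) : ℝ) * (w j - M / K ^ 3) := by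
      simp_rw [mul_sub, sum_sub_distrib]
      rw [← sum_mul, h0, zero_mul, sub_zero]
    rw [h1, ← hKE]
    refine (abs_sum_le_sum_abs _ _).trans ?_
    refine (sum_le_sum (g := fun _ => E) fun j _ => ?_).trans (by simp)
    rw [abs_mul]
    have : |(torusSign α₁ β (gridPoint j) : ℝ)| = 1 := by
      rw [torusSign]
      exact_mod_cast abs_chiSign _
    rw [this, one_mul]
    exact hwE j
  have hbad : ∑ j : Fin 3 → Fin K, (if NearJump α₁ β δ (gridPoint j) then (1 : ℝ) else 0) * w j
      ≤ A * 7 * M / J := by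
    have h1 : ∀ j, w j ≤ 7 * M / K ^ 3 := by
      intro j
      have h2 := (abs_le.1 (hwE j)).2
      have h3 : E ≤ 6 * M / K ^ 3 := by
        rw [le_div_iff₀ (by positivity), mul_comm, hKE]
        exact div_le_self (by positivity) hJ'
      have : (7 : ℝ) * M / K ^ 3 = 6 * M / K ^ 3 + M / K ^ 3 := by ring
      linarith
    have h4 : ∑ j : Fin 3 → Fin K, (if NearJump α₁ β δ (gridPoint j) then (1 : ℝ) else 0)
        ≤ A * (K ^ 2 * J ^ 2) := by
      refine (sum_nearJump_le hK α₁ β hδ.le).trans ?_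
      have h5 : (K : ℝ) * δ = J ^ 2 := by
        rw [hKJ, hδdef]
        field_simp
      have h6 : (1 : ℝ) ≤ J ^ 2 := one_le_pow₀ hJ'
      have h7 : (K : ℝ) ^ 2 * 1 ≤ K ^ 2 * J ^ 2 := by gcongr
      calc _ = (2 + 2 * L₁ + 4 * L) * (K ^ 2 * (K * δ)) + 4 * (K ^ 2 * 1) := by
            simp only [L₁, L]
            ring
        _ ≤ (2 + 2 * L₁ + 4 * L) * (K ^ 2 * J ^ 2) + 4 * (K ^ 2 * J ^ 2) := by
            rw [h5]
            gcongr
        _ = _ := by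
            simp only [A]
            ring
    calc _ ≤ ∑ j : Fin 3 → Fin K, (if NearJump α₁ β δ (gridPoint j) then (1 : ℝ) else 0) *
          (7 * M / K ^ 3) := by
          refine sum_le_sum fun j _ => mul_le_mul_of_nonneg_left (h1 j) ?_
          split_ifs <;> norm_num
      _ ≤ A * (K ^ 2 * J ^ 2) * (7 * M / K ^ 3) := by
          rw [← sum_mul]
          gcongr
      _ = A * 7 * M / J := by
          rw [hKJ]
          field_simp
  have htotal : |∑ m ∈ range M, (torusSign α₁ β (x m) : ℝ)
      - ∑ j, (torusSign α₁ β (gridPoint j) : ℝ) * w j|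
      ≤ 2 * (A * 7 * M / J) + 6 * M / J := by
    have h1 : ∑ j, (torusSign α₁ β (gridPoint j) : ℝ) * w j = ∑ m ∈ range M, ∑ j : Fin 3 → Fin K,
        (torusSign α₁ β (gridPoint j) : ℝ) * ∏ i, fejer K (x m i - gridPoint j i) := by
      simp_rw [hw, mul_sum]
      rw [sum_comm]
    have h2 : ∑ j : Fin 3 → Fin K, (if NearJump α₁ β δ (gridPoint j) then (1 : ℝ) else 0) * w j
        = ∑ m ∈ range M, ∑ j : Fin 3 → Fin K,
        (if NearJump α₁ β δ (gridPoint j) then (1 : ℝ) else 0) *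
          ∏ i, fejer K (x m i - gridPoint j i) := by
      simp_rw [hw, mul_sum]
      rw [sum_comm]
    rw [h1, ← sum_sub_distrib]
    refine (abs_sum_le_sum_abs _ _).trans
      ((sum_le_sum fun m _ => abs_torusSign_sub_le hK α₁ β hδ (x m)).trans ?_)
    rw [sum_add_distrib, ← mul_sum, ← h2, sum_const, card_range, nsmul_eq_mul]
    have h3 : (K : ℝ) * δ ^ 2 = J := by
      rw [hKJ, hδdef]
      field_simp
    rw [h3]
    have h4 : (M : ℝ) * (6 / J) = 6 * M / J := by ring
    rw [h4]
    gcongr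
  have h1 := abs_sub_abs_le_abs_sub (∑ m ∈ range M, (torusSign α₁ β (x m) : ℝ))
    (∑ j, (torusSign α₁ β (gridPoint j) : ℝ) * w j)
  have e : (12 + 14 * A) * M / J = 2 * (A * 7 * M / J) + 6 * M / J + 6 * M / J := by ring
  rw [e]
  linarith

/-! ### Exponential sums for vectors of finite type -/

theorem natDegree_comp_linear_le (p : ℝ[X]) (a b : ℝ) :
    (p.comp (C a * X + C b)).natDegree ≤ p.natDegree := by
  refine natDegree_comp_le.trans ?_
  exact (Nat.mul_le_mul_left _ natDegree_linear_le).trans (by simp)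

theorem coeff_comp_linear {p : ℝ[X]} (hp : p.Monic) {a : ℝ} (ha : a ≠ 0) (b : ℝ) :
    (p.comp (C a * X + C b)).coeff p.natDegree = a ^ p.natDegree := by
  have h1 : (C a * X + C b).natDegree = 1 := natDegree_linear ha
  have h := coeff_comp_degree_mul_degree (p := p) (q := C a * X + C b)
    (by rw [h1]; exact one_ne_zero)
  rw [h1, mul_one, hp.leadingCoeff, one_mul, leadingCoeff_linear ha] at h
  exact h

/-- Some polynomial bound on boxes is all that is needed, so `ε = 1` suffices and the exponent may
be rounded up. -/
theorem IsOfFiniteType.exists_le_mul_distNearestInt {s : ℕ} {γ : Fin s → ℝ} {t : ℝ} (ht : 0 < t)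
    (hγ : IsOfFiniteType γ t) : ∃ (c : ℝ) (T : ℕ), 0 < c ∧ ∀ (Q : ℝ) (n : Fin s → ℤ), 1 ≤ Q →
      n ≠ 0 → (∀ i, |(n i : ℝ)| ≤ Q) → c ≤ Q ^ T * distNearestInt (∑ i, n i * γ i) := by
  obtain ⟨c, hc, h⟩ := hγ 1 one_pos
  refine ⟨c, ⌈t + 1⌉₊ * s, hc, fun Q n hQ hn hnQ => (h n hn).trans ?_⟩
  refine mul_le_mul_of_nonneg_right ?_ (distNearestInt_nonneg _)
  calc ∏ j, (max 1 |(n j : ℝ)|) ^ (t + 1) ≤ ∏ _j : Fin s, Q ^ ⌈t + 1⌉₊ := by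
        refine prod_le_prod (fun j _ => by positivity) fun j _ => ?_
        calc (max 1 |(n j : ℝ)|) ^ (t + 1) ≤ Q ^ (t + 1) :=
              Real.rpow_le_rpow (by positivity) (max_le hQ (hnQ j)) (by linarith)
          _ ≤ Q ^ (⌈t + 1⌉₊ : ℝ) := Real.rpow_le_rpow_of_exponent_le hQ (Nat.le_ceil _)
          _ = Q ^ ⌈t + 1⌉₊ := Real.rpow_natCast _ _
    _ = Q ^ (⌈t + 1⌉₊ * s) := by
        rw [prod_const, card_univ, Fintype.card_fin, pow_mul]

theorem IsOfFiniteType.norm_sum_unitExp_le {s : ℕ} {γ : Fin s → ℝ} {t : ℝ} (ht : 0 < t)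
    (hγ : IsOfFiniteType γ t) {p : ℝ[X]} (hp : p.Monic) (hd : 1 ≤ p.natDegree) :
    ∃ (A : ℝ) (B : ℕ), 0 < A ∧ ∀ (J M a : ℕ) (b : ℝ), 1 ≤ a → a ≤ J → A * (J : ℝ) ^ B ≤ M →
      ∀ h : Fin s → ℤ, h ≠ 0 → (∀ i, |h i| < (J ^ 3 : ℕ)) →
      ‖∑ m ∈ range M, unitExp (∑ i, h i * (γ i * p.eval ((a : ℝ) * m + b)))‖
        ≤ 6 * M / (J ^ 10 : ℕ) := by
  obtain ⟨c, T, hc, hγ'⟩ := hγ.exists_le_mul_distNearestInt ht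
  obtain ⟨D, hD⟩ : ∃ D, p.natDegree = D + 1 := ⟨p.natDegree - 1, by omega⟩
  obtain ⟨F, hF⟩ : ∃ F : ℝ, F = ((D + 1).factorial : ℝ) := ⟨_, rfl⟩
  have hF1 : 1 ≤ F := by
    rw [hF]
    exact_mod_cast Nat.one_le_iff_ne_zero.2 (Nat.factorial_ne_zero _)
  set u : ℕ := 10 * 2 ^ D with hu
  -- The power of `J` bounding the coefficients `n * a ^ (D + 1) * h i`: here `|n| ≤ F * H ^ D` with
  -- `H = J ^ u`, `a ≤ J` and `|h i| < J ^ 3`.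
  set e : ℕ := u * D + (D + 1) + 3 with he
  -- Large enough for both `H ^ 2 ≤ M` and `X * H ≤ M`, where `X = Q ^ T / c` comes from finite
  -- type.
  refine ⟨F ^ T / c + 1, e * T + 2 * u, by positivity, fun J M a b ha haJ hJM h hh hhJ => ?_⟩
  have hJ : 1 ≤ J := ha.trans haJ
  have hJ' : (1 : ℝ) ≤ J := by exact_mod_cast hJ
  have ha' : (1 : ℝ) ≤ a := by exact_mod_cast ha
  have haJ' : (a : ℝ) ≤ J := by exact_mod_cast haJ
  set H : ℕ := (J ^ 10) ^ 2 ^ D with hH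
  have hHJ : (H : ℝ) = (J : ℝ) ^ u := by
    rw [hH, hu, pow_mul]
    push_cast
    rfl
  set Q : ℝ := F * (J : ℝ) ^ e with hQ
  have hQ1 : 1 ≤ Q := one_le_mul_of_one_le_of_one_le hF1 (one_le_pow₀ hJ')
  have hFc : 0 < F ^ T / c := by positivity
  set θ : ℝ := ∑ i, h i * γ i with hθ
  set q : ℝ[X] := C θ * p.comp (C (a : ℝ) * X + C b) with hq
  have hqeval : ∀ m : ℕ, q.eval (m : ℝ) = ∑ i, h i * (γ i * p.eval ((a : ℝ) * m + b)) := by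
    intro m
    simp only [hq, eval_mul, eval_C, eval_comp, eval_add, eval_X, hθ, sum_mul, mul_assoc]
  simp_rw [← hqeval]
  refine norm_sum_unitExp_eval_le D (J ^ 10) H M (Q ^ T / c) q (Nat.one_le_pow _ _ hJ) hH ?_
    (by positivity) ?_ ?_ ?_ M le_rfl
  · refine le_trans ?_ hJM
    rw [hHJ, ← pow_mul]
    calc (J : ℝ) ^ (u * 2) ≤ (J : ℝ) ^ (e * T + 2 * u) := pow_le_pow_right₀ hJ' (by omega)
      _ ≤ _ := le_mul_of_one_le_left (by positivity) (by linarith)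
  · refine le_trans ?_ hJM
    calc Q ^ T / c * H = F ^ T / c * (J : ℝ) ^ (e * T + u) := by
          rw [hHJ, hQ, mul_pow, ← pow_mul, pow_add]
          ring
      _ ≤ (F ^ T / c + 1) * (J : ℝ) ^ (e * T + 2 * u) := by
          gcongr
          · linarith
          · omega
  · rw [← hD]
    exact (natDegree_C_mul_le _ _).trans (natDegree_comp_linear_le _ _ _)
  · intro n hn hnle
    rw [← hF] at hnle
    have hcoeff : q.coeff (D + 1) = θ * (a : ℝ) ^ (D + 1) := by
      rw [hq, coeff_C_mul, ← hD, coeff_comp_linear hp (by positivity)]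
    rw [hcoeff]
    have h1 := hγ' Q (fun i => n * (a : ℤ) ^ (D + 1) * h i) hQ1 ?_ ?_
    · have h2 : (n : ℝ) * (θ * (a : ℝ) ^ (D + 1))
          = ∑ i, ((n * (a : ℤ) ^ (D + 1) * h i : ℤ) : ℝ) * γ i := by
        rw [hθ, sum_mul, mul_sum]
        refine sum_congr rfl fun i _ => ?_
        push_cast
        ring
      rw [h2, one_div_div, div_le_iff₀ (by positivity), mul_comm]
      exact h1
    · obtain ⟨i, hi⟩ := Function.ne_iff.1 hh
      refine Function.ne_iff.2 ⟨i, mul_ne_zero (mul_ne_zero hn (by positivity)) hi⟩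
    · intro i
      have h3 : |(h i : ℝ)| ≤ (J : ℝ) ^ 3 := by
        exact_mod_cast (hhJ i).le
      push_cast
      rw [abs_mul, abs_mul, abs_of_nonneg (by positivity : (0 : ℝ) ≤ (a : ℝ) ^ (D + 1))]
      calc |(n : ℝ)| * (a : ℝ) ^ (D + 1) * |(h i : ℝ)|
          ≤ (F * (H : ℝ) ^ D) * (J : ℝ) ^ (D + 1) * (J : ℝ) ^ 3 := by gcongr
        _ = Q := by
          rw [hQ, hHJ, he, pow_add, pow_add, pow_mul]
          ring

/-! ### The well-distribution measure -/

theorem progressionSum_eq_sum_range (e : ℤ → ℤ) (M a : ℕ) (b : ℤ) :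
    progressionSum e M a b = ∑ m ∈ range M, e ((a : ℤ) * m + (a + b)) := by
  rw [progressionSum, ← Ico_add_one_right_eq_Icc, sum_Ico_eq_sum_range]
  refine sum_congr (by simp) fun m _ => ?_
  congr 1
  push_cast
  ring

theorem abs_progressionSum_genPoly_le {α₁ α₂ β : ℝ} {p : ℝ[X]} (hp : p.Monic)
    (hd : 1 ≤ p.natDegree) {t : ℝ} (ht : 0 < t)
    (htype : IsOfFiniteType ![α₂, α₁ * α₂, α₁ * α₂ * β] t) :
    ∃ (A C : ℝ) (B : ℕ), 0 < A ∧ 0 < C ∧ ∀ (J M a : ℕ) (b : ℤ), Even J → 1 ≤ a → a ≤ J →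
      A * (J : ℝ) ^ B ≤ M →
      |(progressionSum (inducedSeq (genPoly α₁ α₂ β p)) M a b : ℝ)| ≤ C * M / J := by
  obtain ⟨A, B, hA, hE⟩ := htype.norm_sum_unitExp_le ht hp hd
  obtain ⟨C, hC, hS⟩ := abs_sum_torusSign_le α₁ β
  refine ⟨A, C, B, hA, hC, fun J M a b hJ2 ha haJ hJM => ?_⟩
  have h := hS J M (by omega) hJ2
    (fun m i => ![α₂, α₁ * α₂, α₁ * α₂ * β] i * p.eval ((a : ℝ) * m + (a + b)))
    (hE J M a (a + b) ha haJ hJM)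
  rw [progressionSum_eq_sum_range]
  convert h using 2
  push_cast
  refine sum_congr rfl fun m _ => ?_
  rw [inducedSeq, genPoly_eq, torusSign]
  push_cast
  rfl

theorem abs_progressionSum_le {e : ℤ → ℤ} (he : ∀ n, |e n| ≤ 1) (M a : ℕ) (b : ℤ) :
    |(progressionSum e M a b : ℝ)| ≤ M := by
  have hs : |progressionSum e M a b| ≤ (M : ℤ) :=
    (abs_sum_le_sum_abs _ _).trans ((sum_le_sum fun m _ => he _).trans (by simp))
  exact_mod_cast hs

theorem theorem1 (α₁ α₂ β : ℝ) (p : Polynomial ℝ) (hp : p.Monic) (hd : 2 ≤ p.natDegree)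
    (t : ℝ) (ht : 0 < t)
    (htype : IsOfFiniteType ![α₂, α₁ * α₂, α₁ * α₂ * β] t) :
    ∃ η : ℝ, 0 < η ∧ ∀ ε : ℝ, 0 < ε → ∃ C : ℝ, 0 < C ∧ ∀ N : ℕ, 1 ≤ N →
      wellDistribution (inducedSeq (genPoly α₁ α₂ β p)) N ≤ C * (N : ℝ) ^ (1 - η + ε) := by
  obtain ⟨A, C, B, hA, hC, hS⟩ := abs_progressionSum_genPoly_le hp (by omega) ht htype
  -- Chosen so that `N ^ (1/2) * N ^ (η * B) = N ^ (1 - η)`: a progression longer than this meets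
  -- the length condition with `J` of order `N ^ η`.
  set η : ℝ := 1 / (2 * (B + 1)) with hη
  have hη0 : 0 < η := by positivity
  have hηB : η * B + η = 1 / 2 := by
    rw [hη]
    field_simp
  have hB0 : 0 ≤ η * B := by positivity
  -- The summands serve short progressions, small `N` and the main case. The bound holds already
  -- without `ε`.
  refine ⟨η, hη0, fun ε hε => ⟨1 + A * 4 ^ B + C, by positivity, fun N hN => ?_⟩⟩
  have hN1 : (1 : ℝ) ≤ N := by exact_mod_cast hN
  have hN0 : (0 : ℝ) < N := by linarith
  -- Nonnegativity of the bound covers the empty set of values at `N = 1`.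
  refine Real.sSup_le ?_ (by positivity)
  rintro x ⟨a, b, M, ha, hM, h1, h2, h3, rfl⟩
  set S := progressionSum (inducedSeq (genPoly α₁ α₂ β p)) M a b
  have hSM : |(S : ℝ)| ≤ M := abs_progressionSum_le (fun n => (abs_chiSign _).le) M a b
  have hMN : |(S : ℝ)| ≤ N :=
    le_of_mem_progressionValues (e := inducedSeq (genPoly α₁ α₂ β p))
      (fun n => (abs_chiSign _).le) ⟨a, b, M, ha, hM, h1, h2, h3, rfl⟩
  suffices hmain : |(S : ℝ)| ≤ (1 + A * 4 ^ B + C) * (N : ℝ) ^ (1 - η) by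
    refine hmain.trans ?_
    gcongr
    linarith
  have hpos : 0 < (N : ℝ) ^ (1 - η) := by positivity
  rcases le_or_gt (M : ℝ) ((N : ℝ) ^ (1 - η)) with hcase | hcase
  · have : 0 < A * 4 ^ B + C := by positivity
    nlinarith
  rcases lt_or_ge ((N : ℝ) ^ (1 / 2 : ℝ)) (A * 4 ^ B) with hsmall | hlarge
  · calc |(S : ℝ)| ≤ N := hMN
      _ = (N : ℝ) ^ (1 / 2 : ℝ) * (N : ℝ) ^ (1 / 2 : ℝ) := by
          rw [← Real.rpow_add hN0]
          norm_num
      _ ≤ (A * 4 ^ B) * (N : ℝ) ^ (1 - η) := by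
          gcongr
          linarith
      _ ≤ _ := by
          gcongr
          linarith
  · set J : ℕ := 2 * ⌈(N : ℝ) ^ η⌉₊ with hJ
    have hNη : 1 ≤ (N : ℝ) ^ η := Real.one_le_rpow hN1 hη0.le
    have hJlow : 2 * (N : ℝ) ^ η ≤ J := by
      rw [hJ]
      push_cast
      linarith [Nat.le_ceil ((N : ℝ) ^ η)]
    have hJup : (J : ℝ) ≤ 4 * (N : ℝ) ^ η := by
      rw [hJ]
      push_cast
      linarith [Nat.ceil_lt_add_one (show 0 ≤ (N : ℝ) ^ η by linarith)]
    have hsplit : (N : ℝ) ^ (1 - η) * (N : ℝ) ^ η = N := by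
      rw [← Real.rpow_add hN0, sub_add_cancel, Real.rpow_one]
    have hM2 : 2 ≤ M := by
      by_contra hlt
      obtain rfl : M = 1 := by omega
      simp at h2
    -- Since `b` may be negative, only the span `a * (M - 1)` is controlled by `N`; `M ≥ 2` makes
    -- this enough, at the cost of a factor 2.
    have haM : (a : ℝ) * M ≤ 2 * N := by
      have h4 : (a : ℤ) * (M - 1) ≤ N := by linarith
      have h5 : (M : ℤ) ≤ 2 * (M - 1) := by omega
      have h6 : (a : ℤ) * M ≤ 2 * N := by nlinarith
      exact_mod_cast h6
    have haJ : a ≤ J := by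
      have h4 : (a : ℝ) * (N : ℝ) ^ (1 - η) ≤ (2 * (N : ℝ) ^ η) * (N : ℝ) ^ (1 - η) := by
        have : (a : ℝ) * (N : ℝ) ^ (1 - η) ≤ a * M := by gcongr
        linarith
      exact_mod_cast (le_of_mul_le_mul_right h4 hpos).trans hJlow
    have hJM : A * (J : ℝ) ^ B ≤ M := by
      calc A * (J : ℝ) ^ B ≤ A * (4 * (N : ℝ) ^ η) ^ B := by gcongr
        _ = (A * 4 ^ B) * (N : ℝ) ^ (η * B) := by
            rw [mul_pow, Real.rpow_mul_natCast hN0.le]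
            ring
        _ ≤ (N : ℝ) ^ (1 / 2 : ℝ) * (N : ℝ) ^ (η * B) := by gcongr
        _ = (N : ℝ) ^ (1 - η) := by
            rw [← Real.rpow_add hN0]
            congr 1
            linarith
        _ ≤ M := hcase.le
    have hMN' : (M : ℝ) ≤ N := by
      have h4 : (M : ℤ) ≤ N := by
        have ha1 : (1 : ℤ) ≤ a := by exact_mod_cast ha
        have hM1 : (1 : ℤ) ≤ M := by exact_mod_cast hM
        nlinarith [mul_nonneg (sub_nonneg.2 ha1) (sub_nonneg.2 hM1)]
      exact_mod_cast h4
    calc |(S : ℝ)| ≤ C * M / J := hS J M a b (even_two_mul _) ha haJ hJM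
      _ ≤ C * N / (N : ℝ) ^ η := by
          gcongr
          linarith
      _ = C * (N : ℝ) ^ (1 - η) := by
          rw [div_eq_iff (by positivity), mul_assoc, hsplit]
      _ ≤ _ := by
          gcongr
          have : 0 < A * 4 ^ B := by positivity
          linarith
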